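/- Let $a>b>0$, $c^2=a^2-b^2$, and let $\mathcal{E}$ be the ellipse $x^2/a^2+y^2/b^2=1$. Let $\mathcal{E}_\triangle$ be the ellipse centred at the origin, with axes along the coordinate axes, with semi-axes $$a_\triangle=\frac{a\,c^2}{a^2+3b^2},\qquad b_\triangle=\frac{b\,c^2}{3a^2+b^2},$$ and let $C=[a_\triangle\cos t,\;b_\triangle\sin t]$, $t\in\mathbb{R}$, be any point on it. There is exactly one $r>0$ such that the circle with center $C$ and radius $r$ lies in the interior of $\mathcal{E}$ and is tangent to the three side lines of some triangle inscribed in $\mathcal{E}$. Consider all triangles inscribed in $\mathcal{E}$ whose three side lines are tangent to this circle (a Poncelet family), and let $\mathcal{L}_5$ be the locus, over this family, of the Euler center $X_5$ (the center of the nine-point circle). Then the minor axis of $\mathcal{L}_5$ collapses to zero: regarded as a (degenerate) ellipse, $\mathcal{L}_5$ has semi-minor axis $b_5=0$ and semi-major axis $l_5/2$. It is exactly the closed segment, of length $l_5>0$, with one endpoint at $C$ and the other at $F'_{5,eq}$, where $$F'_{5,eq}=\left[\frac{(a^4-b^4)\cos t}{2(a^3+3ab^2)},\;\frac{(a^4-b^4)\sin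 t}{2(3a^2b+b^3)}\right],$$ $$l_5^2=\frac{c^8\left(a^6+15a^4b^2+15a^2b^4+b^6-c^6\cos(2t)\right)}{8\,(3a^5b+10a^3b^3+3ab^5)^2}.$$ -/

import Mathlib

open EuclideanGeometry
open scoped Affine

/-- The Euclidean plane. -/
abbrev Plane : Type := EuclideanSpace ℝ (Fin 2)

/-- The ellipse centred at the origin with semi-axes `a` (along `x`) and `b` (along `y`). -/
def outerEllipse (a b : ℝ) : Set Plane :=
  {P | (P 0 / a) ^ 2 + (P 1 / b) ^ 2 = 1}

/-- The open region bounded by `outerEllipse a b`. -/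
def outerEllipseInterior (a b : ℝ) : Set Plane :=
  {P | (P 0 / a) ^ 2 + (P 1 / b) ^ 2 < 1}

/-- `T` is interscribed between the ellipse and the circle `K`: its vertices lie on the ellipse
and its three side lines are tangent to `K`. (`Affine.Triangle` is nondegenerate.) -/
def IsInterscribed (a b : ℝ) (K : Sphere Plane) (T : Affine.Triangle ℝ Plane) : Prop :=
  (∀ i, T.points i ∈ outerEllipse a b) ∧
    ∀ i j, i ≠ j → K.IsTangent line[ℝ, T.points i, T.points j]

/-- The circle `K` is a caustic of Poncelet triangles of the ellipse: it has positive radius, it is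
nested inside the ellipse, and the pair admits an interscribed triangle. -/
def IsTriangleCaustic (a b : ℝ) (K : Sphere Plane) : Prop :=
  0 < K.radius ∧ Metric.closedBall K.center K.radius ⊆ outerEllipseInterior a b ∧
    ∃ T, IsInterscribed a b K T

/-- The Euler center `X₅` of a triangle, the center of its nine-point circle. -/
noncomputable def eulerCenter (T : Affine.Triangle ℝ Plane) : Plane :=
  T.ninePointCircle.center

/-- The locus `L₅` of the Euler center over the triangles interscribed between the ellipse
and the circle `K`. -/
def eulerCenterLocus (a b : ℝ) (K : Sphere Plane) : Set Plane :=
  {P | ∃ T, IsInterscribed a b K T ∧ eulerCenter T = P}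

/-- `S` is an ellipse, possibly degenerate, with semi-major axis `α` and semi-minor axis `β`.
For `β = 0 < α` it is a segment of length `2 * α`. -/
def IsEllipseWithSemiaxes (S : Set Plane) (α β : ℝ) : Prop :=
  0 ≤ β ∧ β ≤ α ∧ ∃ O u v : Plane, ‖u‖ = 1 ∧ ‖v‖ = 1 ∧ inner ℝ u v = 0 ∧
    S = Set.range fun θ : ℝ => O + (α * Real.cos θ) • u + (β * Real.sin θ) • v

/-- The point with parameter `t` on the ellipse centred at the origin with semi-axes
`a c² / (a² + 3 b²)` and `b c² / (3 a² + b²)`, where `c² = a² - b²`. -/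
noncomputable def equilateralEllipsePoint (a b t : ℝ) : Plane :=
  !₂[a * (a ^ 2 - b ^ 2) / (a ^ 2 + 3 * b ^ 2) * Real.cos t,
    b * (a ^ 2 - b ^ 2) / (3 * a ^ 2 + b ^ 2) * Real.sin t]

/-- The endpoint `F'` of the degenerate locus. -/
noncomputable def eulerSegmentEndpoint (a b t : ℝ) : Plane :=
  !₂[(a ^ 4 - b ^ 4) * Real.cos t / (2 * (a ^ 3 + 3 * a * b ^ 2)),
    (a ^ 4 - b ^ 4) * Real.sin t / (2 * (3 * a ^ 2 * b + b ^ 3))]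

/-! In the affine frame where the outer ellipse is the unit circle, the circle of radius `r` becomes
an ellipse with center `P` and foci `P ± iκ`, `κ² = focalSq a b r`. Tangency of all three sides
makes the vertex parameters the roots of a cubic whose coefficients are affine in the product `l` of
the roots, and it forces a closing condition on `P` and `r` (`cayley_of_chordTangent`). Conversely,
when the foci lie in the unit disk the cubic reads `B(z) = l` for a Blaschke product `B` of degree
three, so every unimodular `l` yields three distinct points of the circle and hence a triangle
(`exists_isInterscribed`). The family is thus parametrized by `l`.

The Euler center is real-linear in the sum and the product of the parameters, so in general it
traces an ellipse as `l` turns. At the special centers `conj P ^ 2 + κ² = P e^{-it}`; with `l =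
e^{i(t+φ)}` the sum is `P (2 + e^{iφ})`, and the Euler center depends on `φ` only through `cos φ`
(`eulerPointOf_equilateral`), which is the collapse to a segment. The radius is unique because the
closing condition is quadratic in `r²` and nesting excludes two roots
(`IsTriangleCaustic.radius_unique`). -/

section

open ComplexConjugate

/-! ### Algebra of Poncelet triangles: tangency, the cubic, the closing condition. -/

/-- The chord of the unit circle through `x` and `y` touches the conic centred at `P` that is
determined by `k` and `h`; here `Q` plays the role of the conjugate of `P`. -/
def ChordTangent (P Q k h x y : ℂ) : Prop :=
  (Q * (x * y) + P - (x + y)) ^ 2 = -k * ((x * y) ^ 2 + 1) + 2 * h * (x * y)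

/-- Vieta's relations of the cubic `z (z² - 2Pz + P² + k) = l ((Q² + k) z² - 2Qz + 1)`. -/
structure PonceletVieta (P Q k l x y z : ℂ) : Prop where
  sum : x + y + z = 2 * P + l * (Q ^ 2 + k)
  pairs : x * y + x * z + y * z = P ^ 2 + k + 2 * Q * l
  prod : x * y * z = l

lemma ChordTangent.symm {P Q k h x y : ℂ} (H : ChordTangent P Q k h x y) :
    ChordTangent P Q k h y x := by
  unfold ChordTangent at *
  linear_combination H

/-- For fixed `x` the tangency condition is a quadratic in the other endpoint; these are Vieta's
formulas for its two roots. -/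
lemma ChordTangent.vieta_at {P Q k h x y z : ℂ} (hyz : y ≠ z)
    (hy : ChordTangent P Q k h x y) (hz : ChordTangent P Q k h x z) :
    ((Q ^ 2 + k) * x ^ 2 - 2 * Q * x + 1) * (y + z) =
        -(2 * (Q * x - 1) * (P - x) - 2 * h * x) ∧
      ((Q ^ 2 + k) * x ^ 2 - 2 * Q * x + 1) * (y * z) = x ^ 2 - 2 * P * x + P ^ 2 + k := by
  unfold ChordTangent at *
  have h1 : ((Q ^ 2 + k) * x ^ 2 - 2 * Q * x + 1) * (y + z) =
        -(2 * (Q * x - 1) * (P - x) - 2 * h * x) := by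
    apply mul_left_cancel₀ (sub_ne_zero.2 hyz)
    linear_combination hy - hz
  refine ⟨h1, ?_⟩
  linear_combination y * h1 - hy

/-- Multiplying the product formula at each vertex by that vertex gives one and the same cubic, so
the three distinct vertices are all its roots. Comparing their sum with the sum formula at `x`
leaves the closing condition. -/
lemma cayley_of_chordTangent {P Q k h x y z : ℂ} (hxy : x ≠ y) (hxz : x ≠ z) (hyz : y ≠ z)
    (hx0 : x ≠ 0)
    (h12 : ChordTangent P Q k h x y) (h13 : ChordTangent P Q k h x z)
    (h23 : ChordTangent P Q k h y z) :
    (P ^ 2 + k) * (Q ^ 2 + k) - 2 * P * Q + 1 = 2 * h ∧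
      PonceletVieta P Q k (x * y * z) x y z := by
  have hx := ChordTangent.vieta_at hyz h12 h13
  have hy := ChordTangent.vieta_at hxz h12.symm h23
  have hz := ChordTangent.vieta_at hxy h13.symm h23.symm
  set l := x * y * z with hl
  have ex : x * (x ^ 2 - 2 * P * x + P ^ 2 + k) = l * ((Q ^ 2 + k) * x ^ 2 - 2 * Q * x + 1) := by
    linear_combination (-x) * hx.2
  have ey : y * (y ^ 2 - 2 * P * y + P ^ 2 + k) = l * ((Q ^ 2 + k) * y ^ 2 - 2 * Q * y + 1) := by
    linear_combination (-y) * hy.2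
  have ez : z * (z ^ 2 - 2 * P * z + P ^ 2 + k) = l * ((Q ^ 2 + k) * z ^ 2 - 2 * Q * z + 1) := by
    linear_combination (-z) * hz.2
  -- Divided differences of the cubic; a second difference gives the sum of the roots.
  have d1 : x ^ 2 + x * y + y ^ 2 - (2 * P + l * (Q ^ 2 + k)) * (x + y)
      + (P ^ 2 + k + 2 * Q * l) = 0 := by
    apply mul_left_cancel₀ (sub_ne_zero.2 hxy)
    linear_combination ex - ey
  have d2 : x ^ 2 + x * z + z ^ 2 - (2 * P + l * (Q ^ 2 + k)) * (x + z)
      + (P ^ 2 + k + 2 * Q * l) = 0 := by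
    apply mul_left_cancel₀ (sub_ne_zero.2 hxz)
    linear_combination ex - ez
  have s1 : x + y + z = 2 * P + l * (Q ^ 2 + k) := by
    apply mul_left_cancel₀ (sub_ne_zero.2 hyz)
    linear_combination d1 - d2
  refine ⟨?_, s1, ?_, rfl⟩
  · apply mul_left_cancel₀ hx0
    linear_combination hx.1 - ((Q ^ 2 + k) * x ^ 2 - 2 * Q * x + 1) * s1 + (Q ^ 2 + k) * ex
  · linear_combination (x + y) * s1 - d1

/-- The converse: the closing condition lets the sum and product formulas at `x` be recovered from
the cubic, and they reassemble the tangency quadratic with root `y`. -/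
lemma PonceletVieta.chordTangent {P Q k h l x y z : ℂ} (H : PonceletVieta P Q k l x y z)
    (hc : (P ^ 2 + k) * (Q ^ 2 + k) - 2 * P * Q + 1 = 2 * h)
    (hx0 : x ≠ 0) :
    ChordTangent P Q k h x y := by
  obtain ⟨s1, s2, s3⟩ := H
  have ex : x * (x ^ 2 - 2 * P * x + P ^ 2 + k) = l * ((Q ^ 2 + k) * x ^ 2 - 2 * Q * x + 1) := by
    linear_combination s3 - x * s2 + x ^ 2 * s1
  have e1 : ((Q ^ 2 + k) * x ^ 2 - 2 * Q * x + 1) * (y * z) = x ^ 2 - 2 * P * x + P ^ 2 + k := by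
    apply mul_left_cancel₀ hx0
    linear_combination ((Q ^ 2 + k) * x ^ 2 - 2 * Q * x + 1) * s3 - ex
  have e2 : ((Q ^ 2 + k) * x ^ 2 - 2 * Q * x + 1) * (y + z) =
        -(2 * (Q * x - 1) * (P - x) - 2 * h * x) := by
    linear_combination ((Q ^ 2 + k) * x ^ 2 - 2 * Q * x + 1) * s1 - (Q ^ 2 + k) * ex + x * hc
  unfold ChordTangent
  linear_combination y * e2 - e1

lemma PonceletVieta.rotate {P Q k l x y z : ℂ} (H : PonceletVieta P Q k l x y z) :
    PonceletVieta P Q k l y z x :=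
  ⟨by linear_combination H.sum, by linear_combination H.pairs, by linear_combination H.prod⟩

lemma PonceletVieta.root {P Q k l x y z : ℂ} (H : PonceletVieta P Q k l x y z) :
    x * (x ^ 2 - 2 * P * x + P ^ 2 + k) = l * ((Q ^ 2 + k) * x ^ 2 - 2 * Q * x + 1) := by
  linear_combination H.prod - x * H.pairs + x ^ 2 * H.sum

lemma exists_ponceletVieta (P Q k l : ℂ) : ∃ x y z, PonceletVieta P Q k l x y z := by
  let c : Cubic ℂ := ⟨1, -(2 * P + l * (Q ^ 2 + k)), P ^ 2 + k + 2 * Q * l, -l⟩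
  have ha : c.a ≠ 0 := one_ne_zero
  obtain ⟨x, y, z, h⟩ := (Cubic.splits_iff_roots_eq_three (φ := RingHom.id ℂ) ha).1
    (IsAlgClosed.splits _)
  have h1 := Cubic.b_eq_three_roots ha h
  have h2 := Cubic.c_eq_three_roots ha h
  have h3 := Cubic.d_eq_three_roots ha h
  simp only [c, RingHom.id_apply] at h1 h2 h3
  exact ⟨x, y, z, by linear_combination h1, by linear_combination -h2,
    by linear_combination h3⟩

/-! ### Blaschke products of degree three. -/

lemma normSq_one_sub_conj_mul_sub (f z : ℂ) :
    Complex.normSq (1 - conj f * z) - Complex.normSq (z - f) =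
      (1 - Complex.normSq z) * (1 - Complex.normSq f) := by
  simp [Complex.normSq_apply]
  ring

lemma norm_sub_lt_norm_one_sub_conj_mul {f z : ℂ} (hf : ‖f‖ < 1) (hz : ‖z‖ < 1) :
    ‖z - f‖ < ‖1 - conj f * z‖ := by
  have h := normSq_one_sub_conj_mul_sub f z
  simp only [Complex.normSq_eq_norm_sq] at h
  have h1 : 0 < (1 - ‖z‖ ^ 2) * (1 - ‖f‖ ^ 2) :=
    mul_pos (by nlinarith [norm_nonneg z]) (by nlinarith [norm_nonneg f])
  exact lt_of_pow_lt_pow_left₀ 2 (norm_nonneg _) (by linarith)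

lemma norm_one_sub_conj_mul_lt_norm_sub {f z : ℂ} (hf : ‖f‖ < 1) (hz : 1 < ‖z‖) :
    ‖1 - conj f * z‖ < ‖z - f‖ := by
  have h := normSq_one_sub_conj_mul_sub f z
  simp only [Complex.normSq_eq_norm_sq] at h
  have h1 : 0 < (‖z‖ ^ 2 - 1) * (1 - ‖f‖ ^ 2) :=
    mul_pos (by nlinarith [norm_nonneg z]) (by nlinarith [norm_nonneg f])
  exact lt_of_pow_lt_pow_left₀ 2 (norm_nonneg _) (by linarith)

/-- A unimodular value of a degree three Blaschke product is attained only on the unit circle. -/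
lemma norm_eq_one_of_blaschke {f g l z : ℂ} (hf : ‖f‖ < 1) (hg : ‖g‖ < 1) (hl : ‖l‖ = 1)
    (h : z * ((z - f) * (z - g)) = l * ((1 - conj f * z) * (1 - conj g * z))) : ‖z‖ = 1 := by
  have hn := congrArg norm h
  simp only [norm_mul, hl, one_mul] at hn
  rcases lt_trichotomy ‖z‖ 1 with hz | hz | hz
  · have h1 := norm_sub_lt_norm_one_sub_conj_mul hf hz
    have h2 := norm_sub_lt_norm_one_sub_conj_mul hg hz
    have h3 := mul_lt_mul'' h1 h2 (norm_nonneg _) (norm_nonneg _)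
    have h4 : 0 ≤ ‖z - f‖ * ‖z - g‖ := by positivity
    nlinarith [norm_nonneg z]
  · exact hz
  · have h1 := norm_one_sub_conj_mul_lt_norm_sub hf hz
    have h2 := norm_one_sub_conj_mul_lt_norm_sub hg hz
    have h3 := mul_lt_mul'' h1 h2 (norm_nonneg _) (norm_nonneg _)
    have h4 : 0 ≤ ‖z - f‖ * ‖z - g‖ := by positivity
    nlinarith [norm_nonneg z]

/-- A degree three Blaschke product has no critical points on the unit circle. -/
lemma no_double_root_of_blaschke {f g l z w : ℂ} (hf : ‖f‖ < 1) (hg : ‖g‖ < 1) (hz : ‖z‖ = 1)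
    (h1 : 2 * z + w = f + g + l * (conj f * conj g))
    (h2 : z ^ 2 + 2 * z * w = f * g + l * (conj f + conj g)) (h3 : z ^ 2 * w = l) : False := by
  have hz1 : z * conj z = 1 := by rw [Complex.mul_conj, Complex.normSq_eq_norm_sq, hz]; simp
  have hz0 : z ≠ 0 := by rintro rfl; simp at hz
  have pos : ∀ f : ℂ, ‖f‖ < 1 → 0 < Complex.normSq (z - f) := by
    intro f hf
    rw [Complex.normSq_pos, sub_ne_zero]
    rintro rfl
    linarith
  have hu := pos f hf
  have hv := pos g hg
  have e0 : z * ((z - f) * (z - g)) = l * ((1 - conj f * z) * (1 - conj g * z)) := by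
    linear_combination h3 - z * h2 + z ^ 2 * h1
  have e1 : (z - f) * (z - g) + z * (2 * z - f - g) =
      l * (2 * conj f * conj g * z - (conj f + conj g)) := by
    linear_combination 2 * z * h1 - h2
  -- On the circle, `z B'/B = 1 + (1 - |f|²)/|z - f|² + (1 - |g|²)/|z - g|²`, which is positive. A
  -- double root would make it vanish; denominators are cleared here.
  have key : (Complex.normSq (z - f) * Complex.normSq (z - g)
      + Complex.normSq (z - g) * (1 - Complex.normSq f)
      + Complex.normSq (z - f) * (1 - Complex.normSq g) : ℂ) = 0 := by
    simp only [Complex.normSq_eq_conj_mul_self, map_sub]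
    rw [eq_inv_of_mul_eq_one_right hz1]
    field_simp
    linear_combination (1 - conj f * z) * (1 - conj g * z) * e1 -
      (2 * conj f * conj g * z - (conj f + conj g)) * e0
  have key' : Complex.normSq (z - f) * Complex.normSq (z - g)
      + Complex.normSq (z - g) * (1 - Complex.normSq f)
      + Complex.normSq (z - f) * (1 - Complex.normSq g) = 0 := by exact_mod_cast key
  have := mul_pos hu hv
  have hf2 : Complex.normSq f < 1 := by
    rw [Complex.normSq_eq_norm_sq]; nlinarith [norm_nonneg f]
  have hg2 : Complex.normSq g < 1 := by
    rw [Complex.normSq_eq_norm_sq]; nlinarith [norm_nonneg g]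
  have := mul_pos hv (sub_pos.2 hf2)
  have := mul_pos hu (sub_pos.2 hg2)
  linarith

/-! ### The affine frame and tangency in coordinates. -/

/-- The linear map that carries the unit circle onto the ellipse with semi-axes `a` and `b`. -/
noncomputable def ellipseMap (a b : ℝ) : ℂ →ₗ[ℝ] Plane where
  toFun z := !₂[a * z.re, b * z.im]
  map_add' x y := by ext i; fin_cases i <;> simp <;> ring
  map_smul' c x := by ext i; fin_cases i <;> simp <;> ring

@[simp] lemma ellipseMap_zero_coord (a b : ℝ) (z : ℂ) : ellipseMap a b z 0 = a * z.re := rfl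

@[simp] lemma ellipseMap_one_coord (a b : ℝ) (z : ℂ) : ellipseMap a b z 1 = b * z.im := rfl

lemma ellipseMap_surjective {a b : ℝ} (ha : a ≠ 0) (hb : b ≠ 0) :
    Function.Surjective (ellipseMap a b) := by
  intro X
  refine ⟨⟨X 0 / a, X 1 / b⟩, ?_⟩
  ext i
  fin_cases i <;> simp <;> field_simp

lemma ellipseMap_injective {a b : ℝ} (ha : a ≠ 0) (hb : b ≠ 0) :
    Function.Injective (ellipseMap a b) := by
  intro x y h
  have h0 := congrArg (fun X : Plane => X 0) h
  have h1 := congrArg (fun X : Plane => X 1) h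
  simp only [ellipseMap_zero_coord, ellipseMap_one_coord] at h0 h1
  exact Complex.ext (mul_left_cancel₀ ha h0) (mul_left_cancel₀ hb h1)

lemma sq_add_sq_eq_norm_sq (z : ℂ) : z.re ^ 2 + z.im ^ 2 = ‖z‖ ^ 2 := by
  rw [← Complex.normSq_eq_norm_sq, Complex.normSq_apply]
  ring

lemma ellipseMap_mem_outerEllipse {a b : ℝ} (ha : a ≠ 0) (hb : b ≠ 0) (z : ℂ) :
    ellipseMap a b z ∈ outerEllipse a b ↔ ‖z‖ = 1 := by
  simp only [outerEllipse, Set.mem_ofPred_eq, ellipseMap_zero_coord, ellipseMap_one_coord,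
    mul_div_cancel_left₀ _ ha, mul_div_cancel_left₀ _ hb, sq_add_sq_eq_norm_sq]
  exact pow_eq_one_iff_of_nonneg (norm_nonneg _) two_ne_zero

lemma ellipseMap_mem_outerEllipseInterior {a b : ℝ} (ha : a ≠ 0) (hb : b ≠ 0) (z : ℂ) :
    ellipseMap a b z ∈ outerEllipseInterior a b ↔ ‖z‖ < 1 := by
  simp only [outerEllipseInterior, Set.mem_ofPred_eq, ellipseMap_zero_coord, ellipseMap_one_coord,
    mul_div_cancel_left₀ _ ha, mul_div_cancel_left₀ _ hb, sq_add_sq_eq_norm_sq]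
  exact pow_lt_one_iff_of_nonneg (norm_nonneg _) two_ne_zero

lemma plane_dist_sq (X Y : Plane) : dist X Y ^ 2 = (X 0 - Y 0) ^ 2 + (X 1 - Y 1) ^ 2 := by
  rw [EuclideanSpace.dist_sq_eq, Fin.sum_univ_two, Real.dist_eq, Real.dist_eq, sq_abs, sq_abs]

lemma plane_inner (X Y : Plane) : inner ℝ X Y = X 0 * Y 0 + X 1 * Y 1 := by
  simp [PiLp.inner_apply, Fin.sum_univ_two]
  ring

/-- A line is tangent to a circle iff the squared distance from the center is the squared radius. -/
lemma isTangent_line_iff (K : Sphere Plane) (hK : 0 ≤ K.radius) {X Y : Plane} (hXY : X ≠ Y) :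
    K.IsTangent line[ℝ, X, Y] ↔
      ((Y 0 - X 0) * (K.center 1 - X 1) - (Y 1 - X 1) * (K.center 0 - X 0)) ^ 2 =
        K.radius ^ 2 * ((Y 0 - X 0) ^ 2 + (Y 1 - X 1) ^ 2) := by
  have hD : 0 < (Y 0 - X 0) ^ 2 + (Y 1 - X 1) ^ 2 := by
    rw [← plane_dist_sq]
    exact pow_pos (dist_pos.2 hXY.symm) 2
  constructor
  · rintro ⟨p, hp, hpl, hle⟩
    obtain ⟨s, rfl⟩ := mem_affineSpan_pair_iff_exists_lineMap_eq.1 hpl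
    have hX := Sphere.mem_orthRadius_iff_inner_left.1 (hle (left_mem_affineSpan_pair ℝ X Y))
    have hY := Sphere.mem_orthRadius_iff_inner_left.1 (hle (right_mem_affineSpan_pair ℝ X Y))
    rw [mem_sphere] at hp
    rw [← hp, plane_dist_sq]
    simp only [plane_inner, AffineMap.lineMap_apply, vsub_eq_sub, vadd_eq_add, PiLp.add_apply,
      PiLp.sub_apply, PiLp.smul_apply, smul_eq_mul] at hX hY ⊢
    set d0 := Y 0 - X 0
    set d1 := Y 1 - X 1
    set e0 := s * d0 + X 0 - K.center 0 with he0
    set e1 := s * d1 + X 1 - K.center 1 with he1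
    -- The direction of the line is orthogonal to the radius at the point of contact.
    have h : d0 * e0 + d1 * e1 = 0 := by linear_combination hY - hX
    have h0 : K.center 0 = s * d0 + X 0 - e0 := by rw [he0]; ring
    have h1 : K.center 1 = s * d1 + X 1 - e1 := by rw [he1]; ring
    rw [h0, h1]
    linear_combination (-(d0 * e0 + d1 * e1)) * h
  · intro h
    set d0 := Y 0 - X 0 with hd0
    set d1 := Y 1 - X 1 with hd1
    -- Parameter of the foot of the perpendicular from the center.
    set s := ((K.center 0 - X 0) * d0 + (K.center 1 - X 1) * d1) / (d0 ^ 2 + d1 ^ 2) with hs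
    have hs' : s * (d0 ^ 2 + d1 ^ 2) = (K.center 0 - X 0) * d0 + (K.center 1 - X 1) * d1 :=
      div_mul_cancel₀ _ hD.ne'
    refine ⟨AffineMap.lineMap X Y s, ?_, AffineMap.lineMap_mem_affineSpan_pair s X Y, ?_⟩
    · rw [mem_sphere, ← pow_left_inj₀ dist_nonneg hK two_ne_zero, plane_dist_sq]
      simp only [AffineMap.lineMap_apply, vsub_eq_sub, vadd_eq_add, PiLp.add_apply,
        PiLp.sub_apply, PiLp.smul_apply, smul_eq_mul, ← hd0, ← hd1]
      apply mul_right_cancel₀ hD.ne'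
      rw [← h]
      linear_combination (s * (d0 ^ 2 + d1 ^ 2) -
        ((K.center 0 - X 0) * d0 + (K.center 1 - X 1) * d1)) * hs'
    · refine affineSpan_pair_le_of_mem_of_mem ?_ ?_ <;>
      simp only [Sphere.mem_orthRadius_iff_inner_left, plane_inner, AffineMap.lineMap_apply,
        vsub_eq_sub, vadd_eq_add, PiLp.add_apply, PiLp.sub_apply, PiLp.smul_apply, smul_eq_mul,
        ← hd0, ← hd1]
      · linear_combination (-s) * hs'
      · have hY0 : Y 0 = X 0 + d0 := by rw [hd0]; ring
        have hY1 : Y 1 = X 1 + d1 := by rw [hd1]; ring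
        rw [hY0, hY1]
        linear_combination (1 - s) * hs'

/-- For a circle of radius `r` this is the square of the linear eccentricity of its image in the
frame in which the ellipse is the unit circle. -/
noncomputable def focalSq (a b r : ℝ) : ℝ := r ^ 2 * (1 / b ^ 2 - 1 / a ^ 2)

/-- Half the sum of the squared axes of the image of a circle of radius `r` in the frame in which
the ellipse is the unit circle. -/
noncomputable def axesSq (a b r : ℝ) : ℝ := r ^ 2 * (1 / a ^ 2 + 1 / b ^ 2)

lemma eq_iff_eq_of_sub_eq_mul {u v s t c : ℂ} (hc : c ≠ 0) (h : u - v = c * (s - t)) :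
    u = v ↔ s = t := by
  rw [← sub_eq_zero, h, mul_eq_zero_iff_left hc, sub_eq_zero]

/-- On the unit circle conjugation is inversion, so the real distance condition becomes a rational
identity in `x` and `y`, equivalent to `ChordTangent` up to the nonzero factor `hcoef`. -/
lemma isTangent_ellipseMap_iff {a b r : ℝ} (ha : 0 < a) (hb : 0 < b) (hr : 0 < r) (P : ℂ) {x y : ℂ}
    (hx : ‖x‖ = 1) (hy : ‖y‖ = 1) (hxy : x ≠ y) :
    (⟨ellipseMap a b P, r⟩ : Sphere Plane).IsTangent
        line[ℝ, ellipseMap a b x, ellipseMap a b y] ↔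
      ChordTangent P (conj P) (focalSq a b r) (axesSq a b r) x y := by
  rw [isTangent_line_iff _ hr.le ((ellipseMap_injective ha.ne' hb.ne').ne hxy)]
  simp only [ellipseMap_zero_coord, ellipseMap_one_coord]
  have hx1 : x * conj x = 1 := by rw [Complex.mul_conj, Complex.normSq_eq_norm_sq, hx]; simp
  have hy1 : y * conj y = 1 := by rw [Complex.mul_conj, Complex.normSq_eq_norm_sq, hy]; simp
  have hx0 : x ≠ 0 := by rintro rfl; simp at hx
  have hy0 : y ≠ 0 := by rintro rfl; simp at hy
  have ha' : (a : ℂ) ≠ 0 := by exact_mod_cast ha.ne'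
  have hb' : (b : ℂ) ≠ 0 := by exact_mod_cast hb.ne'
  have hI : Complex.I ^ 2 = -1 := Complex.I_sq
  rw [← Complex.ofReal_inj]
  unfold ChordTangent focalSq axesSq
  push_cast
  simp only [Complex.re_eq_add_conj, Complex.im_eq_sub_conj]
  rw [eq_inv_of_mul_eq_one_right hx1, eq_inv_of_mul_eq_one_right hy1]
  generalize conj P = Q
  have hcoef : (-(a ^ 2 * b ^ 2 * (x - y) ^ 2) / (4 * (x * y) ^ 2) : ℂ) ≠ 0 := by
    have := sub_ne_zero.2 hxy
    simp [*]
  refine eq_iff_eq_of_sub_eq_mul hcoef ?_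
  field_simp
  ring_nf
  simp only [Complex.I_sq]
  ring

/-! ### Nesting of the circle inside the ellipse. -/

lemma ellipseMap_mem_closedBall_iff (a b : ℝ) {r : ℝ} (hr : 0 ≤ r) (w P : ℂ) :
    ellipseMap a b w ∈ Metric.closedBall (ellipseMap a b P) r ↔
      a ^ 2 * (w.re - P.re) ^ 2 + b ^ 2 * (w.im - P.im) ^ 2 ≤ r ^ 2 := by
  rw [Metric.mem_closedBall, ← pow_le_pow_iff_left₀ dist_nonneg hr two_ne_zero, plane_dist_sq]
  simp only [ellipseMap_zero_coord, ellipseMap_one_coord]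
  refine iff_of_eq (congrArg (· ≤ r ^ 2) ?_)
  ring

lemma norm_lt_one_of_nested {a b r : ℝ} (ha : a ≠ 0) (hb : b ≠ 0) (hr : 0 ≤ r) {P : ℂ}
    (hn : Metric.closedBall (ellipseMap a b P) r ⊆ outerEllipseInterior a b) {w : ℂ}
    (hw : a ^ 2 * (w.re - P.re) ^ 2 + b ^ 2 * (w.im - P.im) ^ 2 ≤ r ^ 2) : ‖w‖ < 1 :=
  (ellipseMap_mem_outerEllipseInterior ha hb w).1
    (hn ((ellipseMap_mem_closedBall_iff a b hr w P).2 hw))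

/-- The points `P ± i r/b` of the image of the disk lie in the unit disk; averaging their squared
norms gives `|P|² + r²/b² < 1`. -/
lemma focalSq_lt_of_nested {a b r : ℝ} (ha : 0 < a) (hb : 0 < b) (hr : 0 ≤ r) {P : ℂ}
    (hn : Metric.closedBall (ellipseMap a b P) r ⊆ outerEllipseInterior a b) :
    focalSq a b r < 1 - (P.re ^ 2 + P.im ^ 2) := by
  have key : ∀ s : ℝ, s ^ 2 = r ^ 2 / b ^ 2 → P.re ^ 2 + (P.im + s) ^ 2 < 1 := by
    intro s hs
    have h : ‖P + s * Complex.I‖ < 1 := by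
      refine norm_lt_one_of_nested ha.ne' hb.ne' hr hn ?_
      simp [hs]
      field_simp
      exact le_rfl
    have h2 := sq_add_sq_eq_norm_sq (P + s * Complex.I)
    simp at h2
    nlinarith [norm_nonneg (P + s * Complex.I)]
  have h1 := key (r / b) (by ring)
  have h2 := key (-(r / b)) (by ring)
  have h3 : 0 ≤ r ^ 2 / a ^ 2 := by positivity
  have h4 : focalSq a b r = (r / b) ^ 2 - r ^ 2 / a ^ 2 := by
    unfold focalSq; ring
  nlinarith

/-- Points on or outside the unit circle lie outside the conic with foci `f`, `g` inside the circle
and focal distance sum `|1 - f̄ g|`. -/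
lemma norm_one_sub_lt_add {f g w : ℂ} (hf : ‖f‖ < 1) (hg : ‖g‖ < 1) (hw : 1 ≤ ‖w‖) :
    ‖1 - conj f * g‖ < ‖w - f‖ + ‖w - g‖ := by
  obtain ⟨v, hv, hvw⟩ : ∃ v : ℂ, ‖v‖ = 1 ∧ w = ‖w‖ * v := by
    have h0 : (‖w‖ : ℂ) ≠ 0 := by
      have : ‖w‖ ≠ 0 := by linarith
      exact_mod_cast this
    refine ⟨w / ‖w‖, ?_, by field_simp⟩
    rw [norm_div, Complex.norm_real, norm_norm, div_self]
    linarith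
  -- Radial projection to the circle brings `w` no farther from any point of the disk, so the
  -- estimate is only needed on the circle.
  have proj : ∀ f : ℂ, ‖f‖ < 1 → ‖v - f‖ ≤ ‖w - f‖ := by
    intro f hf
    have hre : (v * conj f).re ≤ 1 := by
      refine (Complex.re_le_norm _).trans ?_
      rw [norm_mul, hv, RCLike.norm_conj]
      linarith
    refine (pow_le_pow_iff_left₀ (norm_nonneg _) (norm_nonneg _) two_ne_zero).1 ?_
    rw [← Complex.normSq_eq_norm_sq, ← Complex.normSq_eq_norm_sq, Complex.normSq_sub,
      Complex.normSq_sub]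
    have h1 : Complex.normSq v = 1 := by rw [Complex.normSq_eq_norm_sq, hv]; norm_num
    have h2 : Complex.normSq w = ‖w‖ ^ 2 := Complex.normSq_eq_norm_sq w
    have h3 : (w * conj f).re = ‖w‖ * (v * conj f).re := by
      conv_lhs => rw [hvw, mul_assoc, Complex.re_ofReal_mul]
    rw [h1, h2, h3]
    nlinarith
  have hv1 : v * conj v = 1 := by rw [Complex.mul_conj, Complex.normSq_eq_norm_sq, hv]; simp
  have hpos : 0 < ‖v - f‖ := by
    rw [norm_pos_iff, sub_ne_zero]
    rintro rfl
    linarith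
  calc ‖1 - conj f * g‖ = ‖conj v * (v - g) + conj (v - f) * g‖ := by
        congr 1
        rw [map_sub]
        linear_combination -hv1
    _ ≤ ‖v - g‖ + ‖v - f‖ * ‖g‖ := by
        refine (norm_add_le _ _).trans_eq ?_
        rw [norm_mul, norm_mul, RCLike.norm_conj, RCLike.norm_conj, hv, one_mul]
    _ < ‖v - g‖ + ‖v - f‖ := by nlinarith
    _ ≤ ‖w - f‖ + ‖w - g‖ := by linarith [proj f hf, proj g hg]

/-- Focal description of a filled ellipse with semi-major axis `A` along `v` and foci `(0, ±κ)`. -/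
lemma add_le_two_mul_of_sq {A B κ u v d e : ℝ} (hA : 0 < A) (hB : 0 < B)
    (hAB : A ^ 2 = B ^ 2 + κ ^ 2) (hd : 0 ≤ d) (he : 0 ≤ e) (hd2 : d ^ 2 = u ^ 2 + (v - κ) ^ 2)
    (he2 : e ^ 2 = u ^ 2 + (v + κ) ^ 2) (h : A ^ 2 * u ^ 2 + B ^ 2 * v ^ 2 ≤ A ^ 2 * B ^ 2) :
    d + e ≤ 2 * A := by
  have hu : u ^ 2 + v ^ 2 ≤ A ^ 2 := by
    have : B ^ 2 * (u ^ 2 + v ^ 2) ≤ B ^ 2 * A ^ 2 := by nlinarith [sq_nonneg (κ * u)]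
    exact le_of_mul_le_mul_left this (by positivity)
  have h1 : d * e ≤ 2 * A ^ 2 - (u ^ 2 + v ^ 2 + κ ^ 2) := by
    refine (pow_le_pow_iff_left₀ (by positivity) (by nlinarith) two_ne_zero).1 ?_
    rw [mul_pow, hd2, he2]
    have hk : κ ^ 2 = A ^ 2 - B ^ 2 := by linarith
    nlinarith
  refine (pow_le_pow_iff_left₀ (by positivity) (by positivity) two_ne_zero).1 ?_
  nlinarith

/-- The closing condition for Poncelet triangles, in the frame in which the outer ellipse is the
unit circle and `P` is the image of the center of the circle of radius `r`. -/
def CayleyCondition (a b r : ℝ) (P : ℂ) : Prop :=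
  (P.re ^ 2 - P.im ^ 2 + focalSq a b r) ^ 2 + (2 * P.re * P.im) ^ 2
    - 2 * (P.re ^ 2 + P.im ^ 2) + 1 = 2 * axesSq a b r

lemma cayleyCondition_iff {a b r : ℝ} {P : ℂ} : CayleyCondition a b r P ↔
    (P ^ 2 + focalSq a b r) * (conj P ^ 2 + focalSq a b r) - 2 * P * conj P + 1 =
      2 * (axesSq a b r : ℂ) := by
  have h : (P ^ 2 + focalSq a b r) * (conj P ^ 2 + focalSq a b r) - 2 * P * conj P + 1 =
      (((P.re ^ 2 - P.im ^ 2 + focalSq a b r) ^ 2 + (2 * P.re * P.im) ^ 2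
        - 2 * (P.re ^ 2 + P.im ^ 2) + 1 : ℝ) : ℂ) := by
    apply Complex.ext <;> simp [pow_two] <;> ring
  rw [h, CayleyCondition]
  norm_cast

/-- The closing condition says `|1 - f̄ g| = 2r/b` for the foci `f`, `g`. The image of the disk has
focal distance sum at most its major axis `2r/b`, while points outside the open unit disk exceed it.
-/
lemma nested_of_cayleyCondition {a b r κ : ℝ} (ha : 0 < a) (hb : 0 < b) (hr : 0 < r) {P : ℂ}
    (hκ : κ ^ 2 = focalSq a b r) (hc : CayleyCondition a b r P)
    (hf : ‖P + κ * Complex.I‖ < 1) (hg : ‖P - κ * Complex.I‖ < 1) :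
    Metric.closedBall (ellipseMap a b P) r ⊆ outerEllipseInterior a b := by
  intro X hX
  obtain ⟨w, rfl⟩ := ellipseMap_surjective ha.ne' hb.ne' X
  rw [ellipseMap_mem_closedBall_iff a b hr.le] at hX
  rw [ellipseMap_mem_outerEllipseInterior ha.ne' hb.ne']
  by_contra! hw
  have h1 := norm_one_sub_lt_add hf hg hw
  have hk : focalSq a b r = (r / b) ^ 2 - (r / a) ^ 2 := by unfold focalSq; ring
  have hh : axesSq a b r = (r / b) ^ 2 + (r / a) ^ 2 := by unfold axesSq; ring
  have h2 : ‖1 - conj (P + κ * Complex.I) * (P - κ * Complex.I)‖ = 2 * (r / b) := by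
    rw [← pow_left_inj₀ (norm_nonneg _) (by positivity) two_ne_zero, ← sq_add_sq_eq_norm_sq]
    simp only [CayleyCondition, ← hκ, hh] at hc
    simp
    linear_combination hc + 2 * (hκ.trans hk)
  have h3 : ‖w - (P + κ * Complex.I)‖ + ‖w - (P - κ * Complex.I)‖ ≤ 2 * (r / b) := by
    refine add_le_two_mul_of_sq (B := r / a) (κ := κ) (u := w.re - P.re) (v := w.im - P.im)
      (by positivity) (by positivity) (by rw [hκ, hk]; ring) (norm_nonneg _) (norm_nonneg _)
      ?_ ?_ ?_
    · rw [← sq_add_sq_eq_norm_sq]; simp; ring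
    · rw [← sq_add_sq_eq_norm_sq]; simp; ring
    · have : r ^ 2 / (a ^ 2 * b ^ 2) * (a ^ 2 * (w.re - P.re) ^ 2 + b ^ 2 * (w.im - P.im) ^ 2) ≤
        r ^ 2 / (a ^ 2 * b ^ 2) * r ^ 2 := by gcongr
      calc _ = _ := ?_
        _ ≤ _ := this
        _ = _ := ?_
      · field_simp
      · field_simp
  linarith

/-! ### The Euler center in terms of vertex parameters. -/

/-- The Euler center of a triangle inscribed in an ellipse. -/
lemma eulerCenter_of_points {a b : ℝ} (ha : a ≠ 0) (hb : b ≠ 0) {T : Affine.Triangle ℝ Plane}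
    {x y z : ℂ} (hx : ‖x‖ = 1) (hy : ‖y‖ = 1) (hz : ‖z‖ = 1)
    (h0 : T.points 0 = ellipseMap a b x) (h1 : T.points 1 = ellipseMap a b y)
    (h2 : T.points 2 = ellipseMap a b z) :
    eulerCenter T =
      !₂[((3 * a ^ 2 + b ^ 2) * (x + y + z).re - (a ^ 2 - b ^ 2) * (x * y * z).re) / (8 * a),
        ((a ^ 2 + 3 * b ^ 2) * (x + y + z).im - (a ^ 2 - b ^ 2) * (x * y * z).im) / (8 * b)] := by
  set O : Plane := !₂[(a ^ 2 - b ^ 2) / (4 * a) * ((x + y + z).re + (x * y * z).re),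
    -((a ^ 2 - b ^ 2) / (4 * b) * ((x + y + z).im - (x * y * z).im))] with hO
  -- The squared distance from `O` to a vertex is symmetric in the three parameters, so `O` is the
  -- circumcenter.
  have key : ∀ x y z : ℂ, ‖x‖ = 1 →
      (a * x.re - (a ^ 2 - b ^ 2) / (4 * a) * ((x + y + z).re + (x * y * z).re)) ^ 2 +
      (b * x.im + (a ^ 2 - b ^ 2) / (4 * b) * ((x + y + z).im - (x * y * z).im)) ^ 2 =
      ((a ^ 2 - b ^ 2) / (4 * a) * ((x + y + z).re + (x * y * z).re)) ^ 2 +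
      ((a ^ 2 - b ^ 2) / (4 * b) * ((x + y + z).im - (x * y * z).im)) ^ 2 + (a ^ 2 + b ^ 2) / 2
      - (a ^ 2 - b ^ 2) / 2 * (x * y + x * z + y * z).re := by
    intro x y z hx
    have hx1 := sq_add_sq_eq_norm_sq x
    rw [hx] at hx1
    have ha1 : a * ((a ^ 2 - b ^ 2) / (4 * a)) = (a ^ 2 - b ^ 2) / 4 := by field_simp
    have hb1 : b * ((a ^ 2 - b ^ 2) / (4 * b)) = (a ^ 2 - b ^ 2) / 4 := by field_simp
    simp only [Complex.add_re, Complex.add_im, Complex.mul_re, Complex.mul_im]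
    generalize (a ^ 2 - b ^ 2) / (4 * a) = m at *
    generalize (a ^ 2 - b ^ 2) / (4 * b) = n at *
    linear_combination
      ((a ^ 2 + b ^ 2) / 2 - (a ^ 2 - b ^ 2) / 2 * (y.re * z.re - y.im * z.im)) * hx1
      - 2 * x.re * ((x.re + y.re + z.re) +
        ((x.re * y.re - x.im * y.im) * z.re - (x.re * y.im + x.im * y.re) * z.im)) * ha1
      + 2 * x.im * ((x.im + y.im + z.im) -
        ((x.re * y.re - x.im * y.im) * z.im + (x.re * y.im + x.im * y.re) * z.re)) * hb1
  have hOc : O = T.circumcenter := by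
    refine T.eq_circumcenter_of_dist_eq (r := √((O 0) ^ 2 + (O 1) ^ 2 + (a ^ 2 + b ^ 2) / 2
      - (a ^ 2 - b ^ 2) / 2 * (x * y + x * z + y * z).re)) ?_ ?_
    · rw [T.independent.affineSpan_eq_top_iff_card_eq_finrank_add_one.2 (by simp)]
      trivial
    · intro i
      rw [← Real.sqrt_sq (dist_nonneg (x := T.points i)), plane_dist_sq]
      congr 1
      have ex := key x y z hx
      have ey := key y x z hy
      have ez := key z x y hz
      fin_cases i
      · simp [h0, hO] at ex ⊢
        linear_combination ex
      · simp [h1, hO] at ey ⊢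
        linear_combination ey
      · simp [h2, hO] at ez ⊢
        linear_combination ez
  have hG : ∀ i, T.centroid i = (T.points 0 i + T.points 1 i + T.points 2 i) / 3 := by
    intro i
    rw [T.centroid_eq_smul_sum_vsub_vadd 0]
    simp [Fin.sum_univ_three]
    ring
  unfold eulerCenter
  rw [Affine.Simplex.ninePointCircle_center, ← hOc]
  ext i
  have := hG i
  fin_cases i
  · simp [h0, h1, h2] at this
    simp [this, hO]
    field_simp
    ring
  · simp [h0, h1, h2] at this
    simp [this, hO]
    field_simp
    ring

/-- The Euler center of the triangle inscribed in the ellipse whose vertices have parameters with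
sum `s` and product `l` in the frame in which the ellipse is the unit circle. -/
noncomputable def eulerPointOf (a b : ℝ) (s l : ℂ) : Plane :=
  !₂[((3 * a ^ 2 + b ^ 2) * s.re - (a ^ 2 - b ^ 2) * l.re) / (8 * a),
    ((a ^ 2 + 3 * b ^ 2) * s.im - (a ^ 2 - b ^ 2) * l.im) / (8 * b)]

/-! ### Parametrization of the Poncelet family and uniqueness of the radius. -/

lemma IsInterscribed.cayley_and_eulerCenter {a b r : ℝ} (ha : 0 < a) (hb : 0 < b) (hr : 0 < r)
    {P : ℂ} {T : Affine.Triangle ℝ Plane} (hT : IsInterscribed a b ⟨ellipseMap a b P, r⟩ T) :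
    CayleyCondition a b r P ∧ ∃ l : ℂ, ‖l‖ = 1 ∧
      eulerCenter T = eulerPointOf a b (2 * P + l * (conj P ^ 2 + focalSq a b r)) l := by
  choose z hz using fun i => ellipseMap_surjective ha.ne' hb.ne' (T.points i)
  have hz1 : ∀ i, ‖z i‖ = 1 := fun i => by
    rw [← ellipseMap_mem_outerEllipse ha.ne' hb.ne', hz]
    exact hT.1 i
  have hne : ∀ i j, i ≠ j → z i ≠ z j := fun i j hij h => by
    refine hij (T.independent.injective ?_)
    rw [← hz, ← hz, h]
  have hch : ∀ i j, i ≠ j →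
      ChordTangent P (conj P) (focalSq a b r) (axesSq a b r) (z i) (z j) := fun i j hij => by
    rw [← isTangent_ellipseMap_iff ha hb hr P (hz1 i) (hz1 j) (hne i j hij), hz, hz]
    exact hT.2 i j hij
  have h0 : z 0 ≠ 0 := by
    rw [← norm_ne_zero_iff, hz1]
    exact one_ne_zero
  obtain ⟨hc, hv⟩ := cayley_of_chordTangent (hne 0 1 (by decide)) (hne 0 2 (by decide))
    (hne 1 2 (by decide)) h0 (hch 0 1 (by decide)) (hch 0 2 (by decide)) (hch 1 2 (by decide))
  refine ⟨cayleyCondition_iff.2 hc, z 0 * z 1 * z 2, by simp [hz1], ?_⟩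
  rw [← hv.sum, eulerCenter_of_points ha.ne' hb.ne' (hz1 0) (hz1 1) (hz1 2) (hz 0).symm (hz 1).symm
    (hz 2).symm]
  rfl

/-- Solve the cubic for the given `l`. The Blaschke lemmas put its roots on the circle and keep them
distinct, and the closing condition makes the chords tangent. -/
lemma exists_isInterscribed {a b r κ : ℝ} (ha : 0 < a) (hb : 0 < b) (hr : 0 < r) {P l : ℂ}
    (hκ : κ ^ 2 = focalSq a b r) (hc : CayleyCondition a b r P)
    (hf : ‖P + κ * Complex.I‖ < 1) (hg : ‖P - κ * Complex.I‖ < 1) (hl : ‖l‖ = 1) :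
    ∃ T, IsInterscribed a b ⟨ellipseMap a b P, r⟩ T ∧
      eulerCenter T = eulerPointOf a b (2 * P + l * (conj P ^ 2 + focalSq a b r)) l := by
  obtain ⟨x, y, z, hv⟩ := exists_ponceletVieta P (conj P) (focalSq a b r) l
  have hk : (κ : ℂ) ^ 2 = focalSq a b r := by exact_mod_cast hκ
  have hI := Complex.I_sq
  have hfc : conj (P + κ * Complex.I) = conj P - κ * Complex.I := by
    simp [sub_eq_add_neg]
  have hgc : conj (P - κ * Complex.I) = conj P + κ * Complex.I := by simp
  have unit : ∀ x y z, PonceletVieta P (conj P) (focalSq a b r) l x y z → ‖x‖ = 1 := by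
    intro x y z hv
    refine norm_eq_one_of_blaschke hf hg hl ?_
    rw [hfc, hgc]
    linear_combination hv.root + (x - l * x ^ 2) * hk + (l * x ^ 2 - x) * κ ^ 2 * hI
  have dist : ∀ x y z, PonceletVieta P (conj P) (focalSq a b r) l x y z → x ≠ y := by
    rintro x y z hv rfl
    refine no_double_root_of_blaschke (w := z) (l := l) hf hg (unit _ _ _ hv) ?_ ?_ ?_
    · rw [hfc, hgc]
      linear_combination hv.sum - l * hk + l * κ ^ 2 * hI
    · rw [hfc, hgc]
      linear_combination hv.pairs - hk + κ ^ 2 * hI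
    · linear_combination hv.prod
  have hx := unit _ _ _ hv
  have hy := unit _ _ _ hv.rotate
  have hz := unit _ _ _ hv.rotate.rotate
  have hxy := dist _ _ _ hv
  have hyz := dist _ _ _ hv.rotate
  have hzx := dist _ _ _ hv.rotate.rotate
  have hcc := cayleyCondition_iff.1 hc
  have ne0 : ∀ x : ℂ, ‖x‖ = 1 → x ≠ 0 := by
    rintro x hx rfl
    simp at hx
  have tan : ∀ x y, ‖x‖ = 1 → ‖y‖ = 1 → x ≠ y →
      ChordTangent P (conj P) (focalSq a b r) (axesSq a b r) x y →
      (⟨ellipseMap a b P, r⟩ : Sphere Plane).IsTangent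
        line[ℝ, ellipseMap a b x, ellipseMap a b y] := fun x y hx hy hxy =>
    (isTangent_ellipseMap_iff ha hb hr P hx hy hxy).2
  have t12 := hv.chordTangent hcc (ne0 x hx)
  have t23 := hv.rotate.chordTangent hcc (ne0 y hy)
  have t31 := hv.rotate.rotate.chordTangent hcc (ne0 z hz)
  have hind : AffineIndependent ℝ ![x, y, z] := by
    refine Cospherical.affineIndependent_of_ne ⟨0, 1, ?_⟩ hxy hzx.symm hyz
    rintro w (rfl | rfl | rfl) <;> simpa
  have hind' := hind.map' (ellipseMap a b).toAffineMap (ellipseMap_injective ha.ne' hb.ne')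
  let T : Affine.Triangle ℝ Plane := ⟨_, hind'⟩
  have h0 : T.points 0 = ellipseMap a b x := rfl
  have h1 : T.points 1 = ellipseMap a b y := rfl
  have h2 : T.points 2 = ellipseMap a b z := rfl
  refine ⟨T, ⟨fun i => ?_, fun i j hij => ?_⟩, ?_⟩
  · fin_cases i
    · exact (ellipseMap_mem_outerEllipse ha.ne' hb.ne' x).2 hx
    · exact (ellipseMap_mem_outerEllipse ha.ne' hb.ne' y).2 hy
    · exact (ellipseMap_mem_outerEllipse ha.ne' hb.ne' z).2 hz
  · fin_cases i <;> fin_cases j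
    · exact absurd rfl hij
    · exact tan x y hx hy hxy t12
    · exact tan x z hx hz hzx.symm t31.symm
    · exact tan y x hy hx hxy.symm t12.symm
    · exact absurd rfl hij
    · exact tan y z hy hz hyz t23
    · exact tan z x hz hx hzx t31
    · exact tan z y hz hy hyz.symm t23.symm
    · exact absurd rfl hij
  · rw [← hv.sum, ← hv.prod, eulerCenter_of_points ha.ne' hb.ne' hx hy hz h0 h1 h2]
    rfl

lemma focalSq_pos {a b r : ℝ} (hb : 0 < b) (hab : b < a) (hr : 0 < r) : 0 < focalSq a b r := by
  refine mul_pos (by positivity) (sub_pos.2 ?_)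
  exact one_div_lt_one_div_of_lt (by positivity) (by gcongr)

/-- For two different radii the squared focal distances would be the two roots of one quadratic with
product `(1 - |P|²)²`, but nesting makes each smaller than `1 - |P|²`. -/
lemma IsTriangleCaustic.radius_unique {a b r r' : ℝ} (hb : 0 < b) (hab : b < a) {P : ℂ}
    (h : IsTriangleCaustic a b ⟨ellipseMap a b P, r⟩)
    (h' : IsTriangleCaustic a b ⟨ellipseMap a b P, r'⟩) : r = r' := by
  have ha := hb.trans hab
  obtain ⟨hr, hn, T, hT⟩ := h
  obtain ⟨hr', hn', T', hT'⟩ := h'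
  dsimp only at hr hr' hn hn'
  have hc := (hT.cayley_and_eulerCenter ha hb hr).1
  have hc' := (hT'.cayley_and_eulerCenter ha hb hr').1
  have hk := focalSq_lt_of_nested ha hb hr.le hn
  have hk' := focalSq_lt_of_nested ha hb hr'.le hn'
  have hk0 := focalSq_pos hb hab hr
  have hk0' := focalSq_pos hb hab hr'
  unfold CayleyCondition axesSq at hc hc'
  unfold focalSq at *
  set u := 1 / b ^ 2 - 1 / a ^ 2
  set v := 1 / a ^ 2 + 1 / b ^ 2
  by_contra hne
  have hsq : r ^ 2 - r' ^ 2 ≠ 0 := by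
    rw [sub_ne_zero]
    exact fun h => hne ((pow_left_inj₀ hr.le hr'.le two_ne_zero).1 h)
  have hs : u ^ 2 * (r ^ 2 + r' ^ 2) + 2 * (u * (P.re ^ 2 - P.im ^ 2) - v) = 0 := by
    apply mul_left_cancel₀ hsq
    linear_combination hc - hc'
  have hprod : (r ^ 2 * u) * (r' ^ 2 * u) = (1 - (P.re ^ 2 + P.im ^ 2)) ^ 2 := by
    linear_combination r ^ 2 * hs - hc
  have := mul_lt_mul'' hk hk' hk0.le hk0'.le
  linarith

/-! ### Segments as degenerate ellipses. -/

lemma plane_ext {X Y : Plane} (h0 : X 0 = Y 0) (h1 : X 1 = Y 1) : X = Y := by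
  ext i
  fin_cases i
  exacts [h0, h1]

/-- A nondegenerate segment is an ellipse with vanishing semi-minor axis. -/
lemma isEllipseWithSemiaxes_segment_iff {C F : Plane} (hCF : C ≠ F) (α β : ℝ) :
    IsEllipseWithSemiaxes (segment ℝ C F) α β ↔ α = dist C F / 2 ∧ β = 0 := by
  have hl : 0 < dist C F := dist_pos.2 hCF
  constructor
  · rintro ⟨hβ, hβα, O, u, v, hu, hv, huv, hS⟩
    have hmem : ∀ θ : ℝ, O + (α * Real.cos θ) • u + (β * Real.sin θ) • v ∈ segment ℝ C F :=
      fun θ => hS ▸ Set.mem_range_self θ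
    -- With `β > 0` the four vertices of the ellipse would be collinear, making the orthonormal `u`
    -- and `v` parallel to one line.
    have hβ0 : β = 0 := by
      by_contra hne
      have hβp : 0 < β := lt_of_le_of_ne hβ (Ne.symm hne)
      have hαp : 0 < α := hβp.trans_le hβα
      have hconst : ∀ X ∈ segment ℝ C F,
          (F 1 - C 1) * (X 0 - C 0) - (F 0 - C 0) * (X 1 - C 1) = 0 := by
        rintro X ⟨s, s', -, -, hss, rfl⟩
        simp only [PiLp.add_apply, PiLp.smul_apply, smul_eq_mul]
        obtain rfl : s = 1 - s' := by linarith
        ring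
      have e1 := hconst _ (hmem 0)
      have e2 := hconst _ (hmem Real.pi)
      have e3 := hconst _ (hmem (Real.pi / 2))
      have e4 := hconst _ (hmem (-(Real.pi / 2)))
      simp at e1 e2 e3 e4
      have f1 : (F 1 - C 1) * u 0 - (F 0 - C 0) * u 1 = 0 := by
        apply mul_left_cancel₀ hαp.ne'
        linear_combination (e1 - e2) / 2
      have f2 : (F 1 - C 1) * v 0 - (F 0 - C 0) * v 1 = 0 := by
        apply mul_left_cancel₀ hβp.ne'
        linear_combination (e3 - e4) / 2
      have hu2 : u 0 ^ 2 + u 1 ^ 2 = 1 := by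
        have := plane_inner u u
        rw [real_inner_self_eq_norm_sq, hu] at this
        linarith
      have hv2 : v 0 ^ 2 + v 1 ^ 2 = 1 := by
        have := plane_inner v v
        rw [real_inner_self_eq_norm_sq, hv] at this
        linarith
      rw [plane_inner] at huv
      have hdet : (u 0 * v 1 - u 1 * v 0) ^ 2 = 1 := by
        linear_combination (v 0 ^ 2 + v 1 ^ 2) * hu2 + hv2 - (u 0 * v 0 + u 1 * v 1) * huv
      have hdet0 : u 0 * v 1 - u 1 * v 0 ≠ 0 := by
        intro h
        rw [h] at hdet
        norm_num at hdet
      refine hCF (plane_ext ?_ ?_)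
      · apply mul_left_cancel₀ hdet0
        linear_combination u 0 * f2 - v 0 * f1
      · apply mul_left_cancel₀ hdet0
        linear_combination u 1 * f2 - v 1 * f1
    subst hβ0
    -- The value of `α` comes from comparing diameters: `2α` on one side, `dist C F` on the other.
    have hdist : ∀ X ∈ segment ℝ C F, ∀ Y ∈ segment ℝ C F, dist X Y ≤ dist C F := by
      intro X hX Y hY
      rw [segment_eq_image_lineMap] at hX hY
      obtain ⟨s, hs, rfl⟩ := hX
      obtain ⟨s', hs', rfl⟩ := hY
      rw [dist_lineMap_lineMap]
      refine mul_le_of_le_one_left hl.le ?_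
      rw [Real.dist_eq, abs_le]
      constructor <;> linarith [hs.1, hs.2, hs'.1, hs'.2]
    refine ⟨le_antisymm ?_ ?_, rfl⟩
    · have h := hdist _ (hmem 0) _ (hmem Real.pi)
      have h2 : O + (α * Real.cos 0) • u + (0 * Real.sin 0) • v -
          (O + (α * Real.cos Real.pi) • u + (0 * Real.sin Real.pi) • v) = (2 * α) • u := by
        simp
        module
      rw [dist_eq_norm, h2, norm_smul, hu, Real.norm_eq_abs, abs_of_nonneg (by linarith)] at h
      linarith
    · have hC := left_mem_segment ℝ C F
      have hF := right_mem_segment ℝ C F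
      rw [hS] at hC hF
      obtain ⟨θ, hθ⟩ := hC
      obtain ⟨φ, hφ⟩ := hF
      have h : C - F = (α * (Real.cos θ - Real.cos φ)) • u := by
        rw [← hθ, ← hφ]
        simp
        module
      rw [dist_eq_norm, h, norm_smul, hu, Real.norm_eq_abs, abs_mul, abs_of_nonneg hβα]
      have : |Real.cos θ - Real.cos φ| ≤ 2 := by
        rw [abs_le]
        constructor <;> linarith [Real.cos_le_one θ, Real.cos_le_one φ, Real.neg_one_le_cos θ,
          Real.neg_one_le_cos φ]
      nlinarith
  · rintro ⟨rfl, rfl⟩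
    set l := dist C F with hldef
    have hl2 : (F 0 - C 0) ^ 2 + (F 1 - C 1) ^ 2 = l ^ 2 := by
      rw [← plane_dist_sq, dist_comm]
    have hn : ‖F - C‖ = l := by rw [← dist_eq_norm, dist_comm]
    refine ⟨le_rfl, by positivity, midpoint ℝ C F, l⁻¹ • (F - C),
      l⁻¹ • !₂[-(F 1 - C 1), F 0 - C 0], ?_, ?_, ?_, ?_⟩
    · rw [norm_smul, hn, Real.norm_eq_abs, abs_of_pos (by positivity), inv_mul_cancel₀ hl.ne']
    · rw [norm_smul, EuclideanSpace.norm_eq, Fin.sum_univ_two]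
      simp only [Real.norm_eq_abs, sq_abs]
      simp only [Matrix.cons_val_zero, Matrix.cons_val_one, neg_sq]
      rw [add_comm, hl2, Real.sqrt_sq hl.le, abs_of_pos (by positivity), inv_mul_cancel₀ hl.ne']
    · rw [plane_inner]
      simp
      ring
    · have hpt : ∀ θ : ℝ, midpoint ℝ C F + (l / 2 * Real.cos θ) • l⁻¹ • (F - C) +
          (0 * Real.sin θ) • l⁻¹ • (!₂[-(F 1 - C 1), F 0 - C 0] : Plane) =
          AffineMap.lineMap C F ((1 + Real.cos θ) / 2) := by
        intro θ
        have : (l / 2 * Real.cos θ) * l⁻¹ = Real.cos θ / 2 := by field_simp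
        rw [smul_smul, this, midpoint_eq_smul_add, AffineMap.lineMap_apply]
        simp only [zero_mul, zero_smul, add_zero, vsub_eq_sub, vadd_eq_add, invOf_eq_inv]
        module
      simp only [hpt]
      rw [segment_eq_image_lineMap]
      ext X
      constructor
      · rintro ⟨s, hs, rfl⟩
        refine ⟨Real.arccos (2 * s - 1), ?_⟩
        dsimp only
        rw [Real.cos_arccos (by linarith [hs.1]) (by linarith [hs.2])]
        ring_nf
      · rintro ⟨θ, rfl⟩
        exact ⟨_, ⟨by linarith [Real.neg_one_le_cos θ], by linarith [Real.cos_le_one θ]⟩, rfl⟩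

/-! ### The special centers: closing condition, nesting and collapse of the locus. -/

/-- The point of the unit disk that corresponds to `equilateralEllipsePoint a b t`. -/
noncomputable def equilateralParam (a b t : ℝ) : ℂ :=
  ⟨(a ^ 2 - b ^ 2) / (a ^ 2 + 3 * b ^ 2) * Real.cos t,
    (a ^ 2 - b ^ 2) / (3 * a ^ 2 + b ^ 2) * Real.sin t⟩

/-- The inradius of the equilateral triangle inscribed in the ellipse with center
`equilateralEllipsePoint a b t`. -/
noncomputable def equilateralInradius (a b t : ℝ) : ℝ :=
  2 * a * b * √(b ^ 2 * Real.cos t ^ 2 / (a ^ 2 + 3 * b ^ 2) ^ 2 +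
    a ^ 2 * Real.sin t ^ 2 / (3 * a ^ 2 + b ^ 2) ^ 2)

lemma ellipseMap_equilateralParam (a b t : ℝ) :
    ellipseMap a b (equilateralParam a b t) = equilateralEllipsePoint a b t := by
  apply plane_ext <;> simp [equilateralParam, equilateralEllipsePoint] <;> ring

variable {a b : ℝ} (t : ℝ)

lemma equilateralInradius_pos (ha : 0 < a) (hb : 0 < b) : 0 < equilateralInradius a b t := by
  refine mul_pos (by positivity) (Real.sqrt_pos.2 ?_)
  by_cases hc : Real.cos t = 0
  · have hs : Real.sin t ^ 2 = 1 := by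
      have := Real.sin_sq_add_cos_sq t
      rw [hc] at this
      linarith
    rw [hs]
    positivity
  · positivity

lemma equilateralInradius_sq :
    equilateralInradius a b t ^ 2 = 4 * a ^ 2 * b ^ 2 *
      (b ^ 2 * Real.cos t ^ 2 / (a ^ 2 + 3 * b ^ 2) ^ 2 +
        a ^ 2 * Real.sin t ^ 2 / (3 * a ^ 2 + b ^ 2) ^ 2) := by
  rw [equilateralInradius, mul_pow, Real.sq_sqrt (by positivity)]
  ring

lemma focalSq_equilateralInradius (ha : 0 < a) (hb : 0 < b) :
    focalSq a b (equilateralInradius a b t) = 4 * (a ^ 2 - b ^ 2) *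
      (b ^ 2 * Real.cos t ^ 2 / (a ^ 2 + 3 * b ^ 2) ^ 2 +
        a ^ 2 * Real.sin t ^ 2 / (3 * a ^ 2 + b ^ 2) ^ 2) := by
  rw [focalSq, equilateralInradius_sq]
  have := ha.ne'
  have := hb.ne'
  field_simp

lemma cayleyCondition_equilateral (ha : 0 < a) (hb : 0 < b) :
    CayleyCondition a b (equilateralInradius a b t) (equilateralParam a b t) := by
  unfold CayleyCondition
  rw [focalSq_equilateralInradius t ha hb, axesSq, equilateralInradius_sq, equilateralParam]
  dsimp only
  have hs : Real.sin t ^ 2 = 1 - Real.cos t ^ 2 := Real.sin_sq t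
  simp only [mul_pow, hs]
  have h1 : a ^ 2 + 3 * b ^ 2 ≠ 0 := by positivity
  have h2 : 3 * a ^ 2 + b ^ 2 ≠ 0 := by positivity
  field_simp
  ring

/-- The squared norm is `|P|² + s² + 2 s Im P`. The bound `2 s Im P ≤ s²` reduces the claim to `|P|²
+ 2s² < 1`. Either sign of `s` is allowed, which covers both foci. -/
lemma norm_focus_equilateral_lt_one (hb : 0 < b) (hab : b < a) {s : ℝ}
    (hs : s ^ 2 = focalSq a b (equilateralInradius a b t)) :
    ‖equilateralParam a b t + s * Complex.I‖ < 1 := by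
  have ha := hb.trans hab
  rw [focalSq_equilateralInradius t ha hb] at hs
  set α := (a ^ 2 - b ^ 2) / (a ^ 2 + 3 * b ^ 2) with hα
  set β := (a ^ 2 - b ^ 2) / (3 * a ^ 2 + b ^ 2) with hβ
  have hd : 0 < a ^ 2 - b ^ 2 := by nlinarith
  have hα1 : α < 1 := by
    rw [hα, div_lt_one (by positivity)]
    nlinarith
  have hβ0 : 0 < β := by positivity
  have hβ1 : 3 * β < 1 := by
    rw [hβ, ← mul_div_assoc, div_lt_one (by positivity)]
    nlinarith
  have hk : s ^ 2 = α * (1 - α) * Real.cos t ^ 2 + β * (1 + β) * Real.sin t ^ 2 := by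
    rw [hs, hα, hβ]
    field_simp
    ring
  have hcs := Real.sin_sq_add_cos_sq t
  have hc0 := sq_nonneg (Real.cos t)
  have hs0 := sq_nonneg (Real.sin t)
  have h1 : 2 * s ^ 2 < 1 - (α ^ 2 * Real.cos t ^ 2 + β ^ 2 * Real.sin t ^ 2) := by
    have e : 1 - (α ^ 2 * Real.cos t ^ 2 + β ^ 2 * Real.sin t ^ 2) - 2 * s ^ 2 =
        (1 - α) ^ 2 * Real.cos t ^ 2 + (1 - 3 * β) * (1 + β) * Real.sin t ^ 2 := by
      rw [hk]
      linear_combination -hcs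
    have p1 : 0 < (1 - α) ^ 2 := by
      have := sub_pos.2 hα1
      positivity
    have p2 : 0 < (1 - 3 * β) * (1 + β) := mul_pos (by linarith) (by linarith)
    have : 0 < (1 - α) ^ 2 * Real.cos t ^ 2 + (1 - 3 * β) * (1 + β) * Real.sin t ^ 2 := by
      by_cases h : Real.cos t = 0
      · have : Real.sin t ^ 2 = 1 := by rw [h] at hcs; linarith
        rw [this, h]
        linarith
      · have : 0 < Real.cos t ^ 2 := by positivity
        positivity
    linarith
  have hα0 : 0 < α := by positivity
  have h2 : 4 * (β * Real.sin t) ^ 2 ≤ s ^ 2 := by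
    rw [hk]
    have p1 : 0 ≤ α * (1 - α) * Real.cos t ^ 2 := by
      have := sub_pos.2 hα1
      positivity
    have p2 : 0 ≤ β * (1 - 3 * β) * Real.sin t ^ 2 := by
      have := sub_pos.2 hβ1
      positivity
    nlinarith
  have h3 : 2 * (β * Real.sin t * s) ≤ s ^ 2 := by
    have h4 := abs_le_of_sq_le_sq (a := 2 * (β * Real.sin t)) (b := |s|)
      (by rw [sq_abs]; linarith) (abs_nonneg s)
    calc 2 * (β * Real.sin t * s) ≤ |2 * (β * Real.sin t) * s| := by
          rw [← mul_assoc]; exact le_abs_self _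
      _ = |2 * (β * Real.sin t)| * |s| := abs_mul _ _
      _ ≤ |s| * |s| := by gcongr
      _ = s ^ 2 := by rw [← sq, sq_abs]
  rw [← pow_lt_one_iff_of_nonneg (norm_nonneg _) two_ne_zero, ← sq_add_sq_eq_norm_sq]
  simp only [equilateralParam, Complex.add_re, Complex.add_im, Complex.mul_re, Complex.mul_im,
    Complex.ofReal_re, Complex.ofReal_im, Complex.I_re, Complex.I_im, ← hα, ← hβ]
  nlinarith

lemma isTriangleCaustic_equilateral (hb : 0 < b) (hab : b < a) :
    IsTriangleCaustic a b ⟨equilateralEllipsePoint a b t, equilateralInradius a b t⟩ := by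
  have ha := hb.trans hab
  have hr := equilateralInradius_pos t ha hb
  have hκ := Real.sq_sqrt (focalSq_pos hb hab hr).le
  have hc := cayleyCondition_equilateral t ha hb
  have hf := norm_focus_equilateral_lt_one t hb hab hκ
  have hg := norm_focus_equilateral_lt_one t hb hab ((neg_sq _).trans hκ)
  rw [Complex.ofReal_neg, neg_mul, ← sub_eq_add_neg] at hg
  rw [← ellipseMap_equilateralParam]
  obtain ⟨T, hT, -⟩ := exists_isInterscribed ha hb hr hκ hc hf hg norm_one
  exact ⟨hr, nested_of_cayleyCondition ha hb hr hκ hc hf hg, T, hT⟩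

/-- The Euler center of the Poncelet triangle whose vertex parameters have product
`exp (i (t + φ))`. -/
lemma eulerPointOf_equilateral (ha : 0 < a) (hb : 0 < b) (φ : ℝ) {l : ℂ}
    (hl : l = ⟨Real.cos (t + φ), Real.sin (t + φ)⟩) :
    eulerPointOf a b (2 * equilateralParam a b t + l * (conj (equilateralParam a b t) ^ 2 +
        focalSq a b (equilateralInradius a b t))) l =
      AffineMap.lineMap (equilateralEllipsePoint a b t) (eulerSegmentEndpoint a b t)
        ((1 - Real.cos φ) / 2) := by
  have h1 : a ^ 2 + 3 * b ^ 2 ≠ 0 := by positivity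
  have h2 : 3 * a ^ 2 + b ^ 2 ≠ 0 := by positivity
  have hs : Real.sin t ^ 2 = 1 - Real.cos t ^ 2 := Real.sin_sq t
  have hsum : 2 * equilateralParam a b t + l * (conj (equilateralParam a b t) ^ 2 +
      focalSq a b (equilateralInradius a b t)) =
      equilateralParam a b t * ⟨2 + Real.cos φ, Real.sin φ⟩ := by
    -- The decisive identity. With `α`, `β` the coefficients of `cos t`, `sin t` in the center, its
    -- imaginary part amounts to `α - β = 2αβ`, and its real part to the chosen radius.
    have hw : conj (equilateralParam a b t) ^ 2 + focalSq a b (equilateralInradius a b t) =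
        equilateralParam a b t * ⟨Real.cos t, -Real.sin t⟩ := by
      apply Complex.ext
      · simp [equilateralParam, sq]
        rw [focalSq_equilateralInradius t ha hb]
        field_simp
        ring
      · simp [equilateralParam, sq]
        field_simp
        ring
    have hexp : l * ⟨Real.cos t, -Real.sin t⟩ = (⟨Real.cos φ, Real.sin φ⟩ : ℂ) := by
      rw [hl, Real.cos_add, Real.sin_add]
      apply Complex.ext
      · simp
        linear_combination Real.cos φ * hs
      · simp
        linear_combination Real.sin φ * hs
    have h3 : (⟨2 + Real.cos φ, Real.sin φ⟩ : ℂ) = 2 + ⟨Real.cos φ, Real.sin φ⟩ := by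
      apply Complex.ext <;> simp
    rw [hw, h3, ← hexp]
    ring
  rw [hsum, hl, Real.cos_add, Real.sin_add]
  apply plane_ext
  · simp [eulerPointOf, equilateralParam, equilateralEllipsePoint, eulerSegmentEndpoint,
      AffineMap.lineMap_apply]
    have h3 : a ^ 3 + 3 * a * b ^ 2 = a * (a ^ 2 + 3 * b ^ 2) := by ring
    rw [h3]
    field_simp
    ring
  · simp [eulerPointOf, equilateralParam, equilateralEllipsePoint, eulerSegmentEndpoint,
      AffineMap.lineMap_apply]
    have h3 : 3 * a ^ 2 * b + b ^ 3 = b * (3 * a ^ 2 + b ^ 2) := by ring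
    rw [h3]
    field_simp
    ring

lemma eulerCenterLocus_equilateral (hb : 0 < b) (hab : b < a) :
    eulerCenterLocus a b ⟨equilateralEllipsePoint a b t, equilateralInradius a b t⟩ =
      segment ℝ (equilateralEllipsePoint a b t) (eulerSegmentEndpoint a b t) := by
  have ha := hb.trans hab
  have hr := equilateralInradius_pos t ha hb
  rw [segment_eq_image_lineMap]
  ext X
  constructor
  · rintro ⟨T, hT, rfl⟩
    rw [← ellipseMap_equilateralParam] at hT
    obtain ⟨-, l, hl, hX⟩ := hT.cayley_and_eulerCenter ha hb hr
    -- The phase `φ` is the argument of `l` measured from `t`.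
    have hl' : l = ⟨Real.cos (t + (l.arg - t)), Real.sin (t + (l.arg - t))⟩ := by
      rw [add_sub_cancel]
      have h := Complex.norm_mul_cos_add_sin_mul_I l
      rw [hl] at h
      rw [← Complex.ofReal_cos, ← Complex.ofReal_sin, Complex.ofReal_one, one_mul,
        ← Complex.mk_eq_add_mul_I] at h
      exact h.symm
    rw [hX, eulerPointOf_equilateral t ha hb _ hl']
    exact ⟨_, ⟨by linarith [Real.cos_le_one (l.arg - t)],
      by linarith [Real.neg_one_le_cos (l.arg - t)]⟩, rfl⟩
  · rintro ⟨s, hs, rfl⟩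
    have hκ := Real.sq_sqrt (focalSq_pos hb hab hr).le
    have hc := cayleyCondition_equilateral t ha hb
    have hf := norm_focus_equilateral_lt_one t hb hab hκ
    have hg := norm_focus_equilateral_lt_one t hb hab ((neg_sq _).trans hκ)
    rw [Complex.ofReal_neg, neg_mul, ← sub_eq_add_neg] at hg
    -- Solves `(1 - cos φ) / 2 = s`.
    set φ := Real.arccos (1 - 2 * s) with hφ
    have hl : ‖(⟨Real.cos (t + φ), Real.sin (t + φ)⟩ : ℂ)‖ = 1 := by
      rw [← pow_eq_one_iff_of_nonneg (norm_nonneg _) two_ne_zero, ← sq_add_sq_eq_norm_sq]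
      exact Real.cos_sq_add_sin_sq _
    obtain ⟨T, hT, hX⟩ := exists_isInterscribed ha hb hr hκ hc hf hg hl
    rw [ellipseMap_equilateralParam] at hT
    refine ⟨T, hT, ?_⟩
    rw [hX, eulerPointOf_equilateral t ha hb φ rfl, hφ,
      Real.cos_arccos (by linarith [hs.2]) (by linarith [hs.1])]
    congr 1
    ring

lemma dist_sq_eulerSegmentEndpoint (ha : 0 < a) (hb : 0 < b) :
    dist (equilateralEllipsePoint a b t) (eulerSegmentEndpoint a b t) ^ 2 =
      (a ^ 2 - b ^ 2) ^ 4 *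
          (a ^ 6 + 15 * a ^ 4 * b ^ 2 + 15 * a ^ 2 * b ^ 4 + b ^ 6
            - (a ^ 2 - b ^ 2) ^ 3 * Real.cos (2 * t)) /
        (8 * (3 * a ^ 5 * b + 10 * a ^ 3 * b ^ 3 + 3 * a * b ^ 5) ^ 2) := by
  rw [plane_dist_sq, Real.cos_two_mul]
  simp [equilateralEllipsePoint, eulerSegmentEndpoint]
  have h1 : a ^ 2 + 3 * b ^ 2 ≠ 0 := by positivity
  have h2 : 3 * a ^ 2 + b ^ 2 ≠ 0 := by positivity
  have h3 : a ^ 3 + 3 * a * b ^ 2 = a * (a ^ 2 + 3 * b ^ 2) := by ring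
  have h4 : 3 * a ^ 2 * b + b ^ 3 = b * (3 * a ^ 2 + b ^ 2) := by ring
  have h5 : 3 * a ^ 5 * b + 10 * a ^ 3 * b ^ 3 + 3 * a * b ^ 5 =
    a * b * (a ^ 2 + 3 * b ^ 2) * (3 * a ^ 2 + b ^ 2) := by ring
  have hs : Real.sin t ^ 2 = 1 - Real.cos t ^ 2 := Real.sin_sq t
  rw [h3, h4, h5]
  field_simp
  rw [hs]
  ring

lemma equilateralEllipsePoint_ne_eulerSegmentEndpoint (hb : 0 < b) (hab : b < a) :
    equilateralEllipsePoint a b t ≠ eulerSegmentEndpoint a b t := by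
  intro h
  have ha := hb.trans hab
  have hd := dist_sq_eulerSegmentEndpoint t ha hb
  rw [h, dist_self] at hd
  have hc : 0 < a ^ 2 - b ^ 2 := by nlinarith
  have hpos : 0 < a ^ 6 + 15 * a ^ 4 * b ^ 2 + 15 * a ^ 2 * b ^ 4 + b ^ 6
            - (a ^ 2 - b ^ 2) ^ 3 * Real.cos (2 * t) := by
    have h1 : (a ^ 2 - b ^ 2) ^ 3 * Real.cos (2 * t) ≤ (a ^ 2 - b ^ 2) ^ 3 :=
      mul_le_of_le_one_right (by positivity) (Real.cos_le_one _)
    -- This is the value of the bracket when `cos (2t) = 1`, its minimum.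
    have h2 : 0 < 18 * a ^ 4 * b ^ 2 + 12 * a ^ 2 * b ^ 4 + 2 * b ^ 6 := by positivity
    nlinarith
  have : 0 < (a ^ 2 - b ^ 2) ^ 4 *
          (a ^ 6 + 15 * a ^ 4 * b ^ 2 + 15 * a ^ 2 * b ^ 4 + b ^ 6
            - (a ^ 2 - b ^ 2) ^ 3 * Real.cos (2 * t)) /
        (8 * (3 * a ^ 5 * b + 10 * a ^ 3 * b ^ 3 + 3 * a * b ^ 5) ^ 2) := by positivity
  rw [← hd] at this
  norm_num at this

end

theorem mainTheorem5 (a b t : ℝ) (hb : 0 < b) (hab : b < a) :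
    (∃! r : ℝ, IsTriangleCaustic a b ⟨equilateralEllipsePoint a b t, r⟩) ∧
    (∀ r : ℝ, IsTriangleCaustic a b ⟨equilateralEllipsePoint a b t, r⟩ →
      (∀ α β : ℝ,
        IsEllipseWithSemiaxes (eulerCenterLocus a b ⟨equilateralEllipsePoint a b t, r⟩) α β ↔
          α = dist (equilateralEllipsePoint a b t) (eulerSegmentEndpoint a b t) / 2 ∧ β = 0) ∧
      eulerCenterLocus a b ⟨equilateralEllipsePoint a b t, r⟩ =
        segment ℝ (equilateralEllipsePoint a b t) (eulerSegmentEndpoint a b t)) ∧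
    0 < dist (equilateralEllipsePoint a b t) (eulerSegmentEndpoint a b t) ∧
    dist (equilateralEllipsePoint a b t) (eulerSegmentEndpoint a b t) ^ 2 =
      (a ^ 2 - b ^ 2) ^ 4 *
          (a ^ 6 + 15 * a ^ 4 * b ^ 2 + 15 * a ^ 2 * b ^ 4 + b ^ 6
            - (a ^ 2 - b ^ 2) ^ 3 * Real.cos (2 * t)) /
        (8 * (3 * a ^ 5 * b + 10 * a ^ 3 * b ^ 3 + 3 * a * b ^ 5) ^ 2) := by
  have ha := hb.trans hab
  have hex := isTriangleCaustic_equilateral t hb hab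
  have huniq : ∀ r, IsTriangleCaustic a b ⟨equilateralEllipsePoint a b t, r⟩ →
      r = equilateralInradius a b t := by
    intro r hr
    rw [← ellipseMap_equilateralParam] at hr hex
    exact hr.radius_unique hb hab hex
  have hne := equilateralEllipsePoint_ne_eulerSegmentEndpoint t hb hab
  refine ⟨⟨_, hex, huniq⟩, fun r hr => ?_, dist_pos.2 hne, dist_sq_eulerSegmentEndpoint t ha hb⟩
  obtain rfl := huniq r hr
  rw [eulerCenterLocus_equilateral t hb hab]
  exact ⟨isEllipseWithSemiaxes_segment_iff hne, rfl⟩
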